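/- Definitions. Let $\sigma=\sigma_1\cdots\sigma_n$ be a permutation of $\{1,\dots,n\}$, $n\ge 1$. It is \emph{separable} if it contains neither $3142$ nor $2413$ as a pattern. A \emph{common interval} of $\sigma$ is a nonempty block of consecutive entries $\sigma_j\sigma_{j+1}\cdots\sigma_k$ whose set of values is an interval of $\mathbb N$; two of them \emph{overlap} if they intersect and neither contains the other; a common interval is \emph{strong} if it overlaps no common interval. The \emph{labeled decomposition tree} of $\sigma$ is the ordered tree of the strong intervals of $\sigma$ under inclusion: its leaves are $\sigma_1,\dots,\sigma_n$ from left to right, its root is $\sigma$, each internal node has at least two children and is their union. An internal node with children $V_1,\dots,V_k$ is \emph{linear} if every union of consecutive children is a common interval, and it is then labeled $+$ or $-$ according to whether the values of its children increase or decrease from left to right; it is \emph{prime} if $k\neq 2$ and no union $V_i\cup\dots\cup V_j$ with $i<j$ and $(i,j)\ne(1,k)$ is a common interval, and it is then labeled by the simple permutation of size $k$ (one whose only common intervals are the single entries and the whole permutation) that gives the relative order of the values of its children. The \emph{expanded decomposition tree} of $\sigma$ is obtained from the labeled one by replacing each linear node with children $V_1,\dots,V_k$ by the left comb $(\cdots((V_1,V_2),V_3),\cdots,V_k)$,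 all of whose $k-1$ binary nodes carry the sign of the replaced node; prime nodes are kept. A \emph{binary separating tree} of $\sigma$ is a binary ordered tree with $n$ leaves, each internal node labeled $+$ or $-$, such that, when the leaves are decorated from left to right by $\sigma_1,\dots,\sigma_n$, the entries below each node form an interval of values, and for each internal node with interval of values $\{i,\dots,j\}$ there is $h\in\{i+1,\dots,j\}$ such that, if the label is $+$, its left child has values $\{i,\dots,h-1\}$ and its right child has values $\{h,\dots,j\}$, and if the label is $-$, its left child has values $\{h,\dots,j\}$ and its right child has values $\{i,\dots,h-1\}$. Proposition. Let $\sigma$ be a separable permutation of size $n\ge1$. Then $\sigma$ has exactly one labeled decomposition tree and exactly one expanded decomposition tree, and the expanded decomposition tree of $\sigma$ is a binary separating tree of $\sigma$. In it, the number of nodes with a given sign is the sum of $k-1$ over all linear nodes with this sign of the labeled decomposition tree, where $k$ is the arity of the node. -/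

import Mathlib

/-! ## Patterns and separable permutations

A permutation of size `n` is an element of `Equiv.Perm (Fin n)`, so positions and values
are both numbered `0, …, n - 1`. -/

/-- `π` is a pattern of `σ`: some increasing sequence of positions of `σ` carries values that
are ordered as the entries of `π`. -/
def ContainsPattern {n k : ℕ} (σ : Equiv.Perm (Fin n)) (π : Equiv.Perm (Fin k)) : Prop :=
  ∃ f : Fin k → Fin n, StrictMono f ∧ ∀ l m : Fin k, π l < π m → σ (f l) < σ (f m)

/-- The permutation `3 1 4 2`, with its values shifted down by one. -/
def perm3142 : Equiv.Perm (Fin 4) where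
  toFun := ![2, 0, 3, 1]
  invFun := ![1, 3, 0, 2]
  left_inv := by decide
  right_inv := by decide

/-- The permutation `2 4 1 3`, with its values shifted down by one. -/
def perm2413 : Equiv.Perm (Fin 4) where
  toFun := ![1, 3, 0, 2]
  invFun := ![2, 0, 3, 1]
  left_inv := by decide
  right_inv := by decide

/-- A permutation is separable if it avoids `3 1 4 2` and `2 4 1 3`. -/
def IsSeparablePerm {n : ℕ} (σ : Equiv.Perm (Fin n)) : Prop :=
  ¬ ContainsPattern σ perm3142 ∧ ¬ ContainsPattern σ perm2413

/-! ## Common intervals and strong intervals -/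

/-- A common interval of `σ`, given by its set of positions: a nonempty set of consecutive
positions whose values are consecutive as well. -/
def IsCommonInterval {n : ℕ} (σ : Equiv.Perm (Fin n)) (S : Set (Fin n)) : Prop :=
  S.Nonempty ∧ S.OrdConnected ∧ (σ '' S).OrdConnected

/-- Two sets overlap if they meet and neither contains the other. -/
def Overlap {α : Type*} (S T : Set α) : Prop :=
  (S \ T).Nonempty ∧ (T \ S).Nonempty ∧ (S ∩ T).Nonempty

/-- A strong interval is a common interval that overlaps no common interval. -/
def IsStrongInterval {n : ℕ} (σ : Equiv.Perm (Fin n)) (S : Set (Fin n)) : Prop :=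
  IsCommonInterval σ S ∧ ∀ T : Set (Fin n), IsCommonInterval σ T → ¬ Overlap S T

/-- A permutation is simple if its only common intervals are the singletons and the whole. -/
def IsSimplePerm {n : ℕ} (π : Equiv.Perm (Fin n)) : Prop :=
  ∀ S : Set (Fin n), IsCommonInterval π S → S = Set.univ ∨ ∃ i, S = {i}

/-! ## Trees -/

/-- The labels `+` and `-`. -/
inductive NodeSign : Type
  | plus : NodeSign
  | minus : NodeSign
  deriving DecidableEq

/-- Ordered trees whose internal nodes are linear nodes labeled by a sign, or prime nodes
of arity `k` labeled by a permutation of size `k`. -/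
inductive DecompTree : Type
  | leaf : DecompTree
  | linear (s : NodeSign) (k : ℕ) (c : Fin k → DecompTree) : DecompTree
  | prime (k : ℕ) (π : Equiv.Perm (Fin k)) (c : Fin k → DecompTree) : DecompTree

/-- Binary ordered trees whose internal nodes are labeled by a sign. -/
inductive SignedBinTree : Type
  | leaf : SignedBinTree
  | node (s : NodeSign) (l r : SignedBinTree) : SignedBinTree

/-- The `l` consecutive positions `a, a + 1, …, a + l - 1` (those that are less than `n`). -/
def block (n a l : ℕ) : Set (Fin n) := {p | a ≤ p.val ∧ p.val < a + l}

namespace DecompTree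

def numLeaves : DecompTree → ℕ
  | leaf => 1
  | linear _ _ c => ∑ i, (c i).numLeaves
  | prime _ _ c => ∑ i, (c i).numLeaves

/-- The first position of the `i`-th subtree in the list `c`, when the leaves of the whole list
are placed from left to right at the positions `a, a + 1, …`. -/
def start {k : ℕ} (c : Fin k → DecompTree) (a : ℕ) (i : Fin k) : ℕ :=
  a + ∑ j ∈ Finset.Iio i, (c j).numLeaves

/-- The set of positions of the leaves of the `i`-th subtree in the list `c`. -/
def childBlock (n : ℕ) {k : ℕ} (c : Fin k → DecompTree) (a : ℕ) (i : Fin k) : Set (Fin n) :=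
  block n (start c a i) (c i).numLeaves

/-- The union of the consecutive subtrees number `i, …, j` in the list `c`. -/
def childUnion (n : ℕ) {k : ℕ} (c : Fin k → DecompTree) (a : ℕ) (i j : Fin k) : Set (Fin n) :=
  ⋃ m ∈ Set.Icc i j, childBlock n c a m

/-- The sets of positions that decorate the nodes (internal nodes and leaves) of a tree whose
leaves are placed from left to right at the positions `a, a + 1, …`. -/
def nodeBlocks (n : ℕ) : DecompTree → ℕ → Set (Set (Fin n))
  | leaf, a => {block n a 1}
  | linear s k c, a =>
      {block n a (linear s k c).numLeaves} ∪ ⋃ i, (c i).nodeBlocks n (start c a i)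
  | prime k π c, a =>
      {block n a (prime k π c).numLeaves} ∪ ⋃ i, (c i).nodeBlocks n (start c a i)

/-- Every internal node has at least two children. -/
def Branching : DecompTree → Prop
  | leaf => True
  | linear _ k c => 2 ≤ k ∧ ∀ i, (c i).Branching
  | prime k _ c => 2 ≤ k ∧ ∀ i, (c i).Branching

/-- All values of `σ` on `S` are smaller than all values of `σ` on `T`. -/
def ValuesBelow {n : ℕ} (σ : Equiv.Perm (Fin n)) (S T : Set (Fin n)) : Prop :=
  ∀ p ∈ S, ∀ q ∈ T, σ p < σ q

/-- The children of a node with label `+` (`-`) increase (decrease) in value from left to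
right. -/
def SignCorrect {n : ℕ} (σ : Equiv.Perm (Fin n)) (s : NodeSign) {k : ℕ}
    (V : Fin k → Set (Fin n)) : Prop :=
  match s with
  | .plus => ∀ i j : Fin k, i < j → ValuesBelow σ (V i) (V j)
  | .minus => ∀ i j : Fin k, i < j → ValuesBelow σ (V j) (V i)

/-- The types and labels of all internal nodes are those prescribed by `σ`. At a linear node every
union of consecutive children is an interval, and the sign is the direction of the values. At
a prime node (of arity other than two) no union of consecutive children is an interval, apart from
single children and the whole, and the label is the simple permutation that gives the
relative order of the children. -/
def LabelsCorrect {n : ℕ} (σ : Equiv.Perm (Fin n)) : DecompTree → ℕ → Prop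
  | leaf, _ => True
  | linear s _ c, a =>
      (∀ i j, i ≤ j → IsCommonInterval σ (childUnion n c a i j)) ∧
      SignCorrect σ s (childBlock n c a) ∧
      ∀ i, (c i).LabelsCorrect σ (start c a i)
  | prime k π c, a =>
      k ≠ 2 ∧
      (∀ i j : Fin k, i < j → ¬ (i.val = 0 ∧ j.val + 1 = k) →
        ¬ IsCommonInterval σ (childUnion n c a i j)) ∧
      IsSimplePerm π ∧
      (∀ i j, π i < π j ↔ ValuesBelow σ (childBlock n c a i) (childBlock n c a j)) ∧
      ∀ i, (c i).LabelsCorrect σ (start c a i)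

/-- `T` is the labeled decomposition tree of `σ`: its leaves are the entries of `σ` from left to
right, its nodes are exactly the strong intervals of `σ` (ordered by inclusion), and its internal
nodes have the types and labels prescribed by `σ`. -/
def IsLabeledDecompTreeOf {n : ℕ} (T : DecompTree) (σ : Equiv.Perm (Fin n)) : Prop :=
  T.numLeaves = n ∧ T.Branching ∧
  (∀ S : Set (Fin n), S ∈ T.nodeBlocks n 0 ↔ IsStrongInterval σ S) ∧
  T.LabelsCorrect σ 0

/-- The left comb `(…((V₁, V₂), V₃), …, V_k)` all of whose internal nodes are binary and carry
the sign `s`. The value for `k = 0` is irrelevant. -/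
def leftComb (s : NodeSign) : (k : ℕ) → (Fin k → DecompTree) → DecompTree
  | 0, _ => leaf
  | 1, c => c 0
  | k + 2, c => linear s 2 ![leftComb s (k + 1) (fun i => c i.castSucc), c (Fin.last (k + 1))]

/-- Replace every linear node by the left comb of its children; prime nodes are kept. -/
def expand : DecompTree → DecompTree
  | leaf => leaf
  | linear s k c => leftComb s k (fun i => (c i).expand)
  | prime k π c => prime k π (fun i => (c i).expand)

/-- `E` is the expanded decomposition tree of `σ`. -/
def IsExpandedDecompTreeOf {n : ℕ} (E : DecompTree) (σ : Equiv.Perm (Fin n)) : Prop :=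
  ∃ T : DecompTree, T.IsLabeledDecompTreeOf σ ∧ E = T.expand

/-- The sum of `k - 1` over all linear nodes labeled `s`, where `k` is the arity of the node. -/
def linearExcess (s : NodeSign) : DecompTree → ℕ
  | leaf => 0
  | linear t k c => (if t = s then k - 1 else 0) + ∑ i, (c i).linearExcess s
  | prime _ _ c => ∑ i, (c i).linearExcess s

end DecompTree

/-! ## Binary separating trees -/

/-- The set of values, as natural numbers, that `σ` takes on `S`. -/
def valueSet {n : ℕ} (σ : Equiv.Perm (Fin n)) (S : Set (Fin n)) : Set ℕ :=
  (fun p => (σ p).val) '' S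

namespace SignedBinTree

def numLeaves : SignedBinTree → ℕ
  | leaf => 1
  | node _ l r => l.numLeaves + r.numLeaves

/-- If the leaves are decorated from left to right by the entries of `σ` at the positions
`a, a + 1, …`, then every node is decorated by an interval of values; at a node labeled `+` that
is decorated by `{i, …, j - 1}` the left child is decorated by `{i, …, h - 1}` and the right child
by `{h, …, j - 1}` for some `i < h < j`, and at a node labeled `-` the other way round. -/
def Separates {n : ℕ} (σ : Equiv.Perm (Fin n)) : SignedBinTree → ℕ → Prop
  | leaf, a => ∃ i, valueSet σ (block n a 1) = Set.Ico i (i + 1)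
  | node s l r, a =>
      (∃ i h j : ℕ, i < h ∧ h < j ∧
        valueSet σ (block n a (node s l r).numLeaves) = Set.Ico i j ∧
        match s with
        | .plus => valueSet σ (block n a l.numLeaves) = Set.Ico i h ∧
            valueSet σ (block n (a + l.numLeaves) r.numLeaves) = Set.Ico h j
        | .minus => valueSet σ (block n a l.numLeaves) = Set.Ico h j ∧
            valueSet σ (block n (a + l.numLeaves) r.numLeaves) = Set.Ico i h) ∧
      l.Separates σ a ∧ r.Separates σ (a + l.numLeaves)

/-- `B` is a binary separating tree of `σ`. -/
def IsSeparatingTreeOf {n : ℕ} (B : SignedBinTree) (σ : Equiv.Perm (Fin n)) : Prop :=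
  B.numLeaves = n ∧ B.Separates σ 0

/-- A signed binary tree, seen as a tree all of whose internal nodes are linear of arity two. -/
def toDecompTree : SignedBinTree → DecompTree
  | leaf => .leaf
  | node s l r => .linear s 2 ![l.toDecompTree, r.toDecompTree]

/-- The number of internal nodes labeled `s`. -/
def numSigned (s : NodeSign) : SignedBinTree → ℕ
  | leaf => 0
  | node t l r => (if t = s then 1 else 0) + l.numSigned s + r.numSigned s

end SignedBinTree

/-! Call `m` a cut of the segment `[a, b)` if all values left of `m` lie below all values from `m`
on; reversing values (`orient`) turns the decreasing analogue into this one. Everything rests on one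
fact: in a separable permutation every segment with at least two positions has an interior cut,
increasing or decreasing (`IsSeparablePerm.exists_isCut`).

Existence: a strong interval with at least two entries is sliced at all its cuts of one sign. The
slices between consecutive cuts are strong (`IsCut.isStrongInterval`), and every strictly smaller
strong interval lies in one slice (`IsCut.not_mem_strong`). The slices are therefore the children of
a linear node, and recursion on the length yields the tree (`exists_tree`).

Uniqueness: a prime node would have a simple label of size at least 3. Such a label has no cut, so
it contains a forbidden pattern, and so does `σ`. Hence all nodes are linear. The family of blocks
determines the shape of a branching tree, and the values determine each sign
(`eq_of_nodeBlocks_eq`).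

Expansion: every initial union of children of a linear node is a common interval, and the next child
lies entirely above or below it. Hence each node of the comb separates values as required
(`exists_separates_leftComb`), and a comb on `k` children has `k - 1` nodes. -/

/-! ## Segments and cuts -/

/-- The positions `x, …, y - 1`. -/
def seg (n x y : ℕ) : Set (Fin n) := {p | x ≤ p.val ∧ p.val < y}

theorem mem_seg {n x y : ℕ} {p : Fin n} : p ∈ seg n x y ↔ x ≤ p.val ∧ p.val < y := Iff.rfl

theorem mem_block {n a l : ℕ} {p : Fin n} : p ∈ block n a l ↔ a ≤ p.val ∧ p.val < a + l := Iff.rfl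

theorem block_eq_seg (n a l : ℕ) : block n a l = seg n a (a + l) := rfl

theorem block_subset_iff {n a l x y : ℕ} (hxy : x < y) (hy : y ≤ n) :
    seg n x y ⊆ block n a l ↔ a ≤ x ∧ y ≤ a + l := by
  constructor
  · intro h
    have h1 := h (show (⟨x, by omega⟩ : Fin n) ∈ seg n x y from ⟨le_rfl, hxy⟩)
    have h2 := h (show (⟨y - 1, by omega⟩ : Fin n) ∈ seg n x y by
      rw [mem_seg]; dsimp only; omega)
    rw [mem_block] at h1 h2
    dsimp only at h1 h2
    omega
  · rintro ⟨h1, h2⟩ p hp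
    rw [mem_seg] at hp
    rw [mem_block]
    omega

theorem IsCommonInterval.exists_seg {n : ℕ} {σ : Equiv.Perm (Fin n)} {S : Set (Fin n)}
    (h : IsCommonInterval σ S) : ∃ x y, x < y ∧ y ≤ n ∧ S = seg n x y := by
  obtain ⟨hne, hoc, -⟩ := h
  obtain ⟨u, hu, hmin⟩ := Set.exists_min_image S id S.toFinite hne
  obtain ⟨v, hv, hmax⟩ := Set.exists_max_image S id S.toFinite hne
  refine ⟨u, v + 1, ?_, v.isLt, ?_⟩
  · have := hmin v hv
    simp only [id, Fin.le_def] at this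
    omega
  · ext p
    rw [mem_seg]
    constructor
    · intro hp
      have h1 := hmin p hp
      have h2 := hmax p hp
      simp only [id, Fin.le_def] at h1 h2
      omega
    · intro hp
      exact hoc.out hu hv ⟨Fin.le_def.2 hp.1, Fin.le_def.2 (by omega)⟩

/-- Since `σ` is onto, convexity of the image can be tested on positions; strict inequalities
suffice because `σ` is injective. -/
theorem isCommonInterval_seg_iff {n : ℕ} {σ : Equiv.Perm (Fin n)} {x y : ℕ} (hxy : x < y)
    (hy : y ≤ n) : IsCommonInterval σ (seg n x y) ↔
      ∀ p ∈ seg n x y, ∀ q ∈ seg n x y, ∀ r, σ p < σ r → σ r < σ q → r ∈ seg n x y := by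
  constructor
  · rintro ⟨-, -, h⟩ p hp q hq r h1 h2
    obtain ⟨r', hr', he⟩ :=
      h.out (Set.mem_image_of_mem σ hp) (Set.mem_image_of_mem σ hq) ⟨h1.le, h2.le⟩
    rwa [← σ.injective he]
  · intro h
    refine ⟨⟨⟨x, by omega⟩, le_rfl, hxy⟩, ⟨?_⟩, ⟨?_⟩⟩
    · intro p hp q hq r hr
      rw [mem_seg] at *
      have h1 := Fin.le_def.1 hr.1
      have h2 := Fin.le_def.1 hr.2
      omega
    · rintro _ ⟨p, hp, rfl⟩ _ ⟨q, hq, rfl⟩ v hv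
      obtain ⟨r, rfl⟩ := σ.surjective v
      refine Set.mem_image_of_mem σ ?_
      rcases hv.1.eq_or_lt with h1 | h1
      · rwa [← σ.injective h1]
      rcases hv.2.eq_or_lt with h2 | h2
      · rwa [σ.injective h2]
      exact h p hp q hq r h1 h2

theorem isCommonInterval_univ {n : ℕ} (hn : 0 < n) (σ : Equiv.Perm (Fin n)) :
    IsCommonInterval σ Set.univ := by
  refine ⟨⟨⟨0, hn⟩, trivial⟩, Set.ordConnected_univ, ?_⟩
  rw [Set.image_univ_of_surjective σ.surjective]
  exact Set.ordConnected_univ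

/-! ### Reversal of values -/

/-- The permutation `σ`, with values reversed for the sign `-`. -/
def orient {n : ℕ} (s : NodeSign) (σ : Equiv.Perm (Fin n)) : Equiv.Perm (Fin n) :=
  match s with
  | .plus => σ
  | .minus => σ.trans Fin.revPerm

theorem orient_minus_apply {n : ℕ} (σ : Equiv.Perm (Fin n)) (p : Fin n) :
    orient .minus σ p = Fin.rev (σ p) := rfl

/-- Reversing the order of values only exchanges the roles of the two outer entries in the
betweenness criterion. -/
theorem isCommonInterval_orient {n : ℕ} (s : NodeSign) (σ : Equiv.Perm (Fin n))
    (S : Set (Fin n)) : IsCommonInterval (orient s σ) S ↔ IsCommonInterval σ S := by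
  have key : ∀ x y, x < y → y ≤ n →
      (IsCommonInterval (orient s σ) (seg n x y) ↔ IsCommonInterval σ (seg n x y)) := by
    intro x y hxy hy
    rw [isCommonInterval_seg_iff hxy hy, isCommonInterval_seg_iff hxy hy]
    cases s with
    | plus => rfl
    | minus =>
      simp only [orient_minus_apply, Fin.rev_lt_rev]
      exact ⟨fun h p hp q hq r h1 h2 => h q hq p hp r h2 h1,
        fun h p hp q hq r h1 h2 => h q hq p hp r h2 h1⟩
  constructor
  · intro h
    obtain ⟨x, y, hxy, hy, rfl⟩ := h.exists_seg
    exact (key x y hxy hy).1 h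
  · intro h
    obtain ⟨x, y, hxy, hy, rfl⟩ := h.exists_seg
    exact (key x y hxy hy).2 h

theorem isStrongInterval_orient {n : ℕ} (s : NodeSign) (σ : Equiv.Perm (Fin n))
    (S : Set (Fin n)) : IsStrongInterval (orient s σ) S ↔ IsStrongInterval σ S := by
  simp only [IsStrongInterval, isCommonInterval_orient]

/-! ### Cuts and strong intervals -/

/-- The values on `a, …, m - 1` are below those on `m, …, b - 1`. -/
def IsCut {n : ℕ} (σ : Equiv.Perm (Fin n)) (a b m : ℕ) : Prop :=
  a ≤ m ∧ m ≤ b ∧ DecompTree.ValuesBelow σ (seg n a m) (seg n m b)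

namespace IsCut

variable {n : ℕ} {σ : Equiv.Perm (Fin n)} {a b m m' x y : ℕ}

/-- The endpoints count as cuts, vacuously, so that the children of a node run between consecutive
cuts with no special case at the ends. -/
theorem left (h : a ≤ b) : IsCut σ a b a :=
  ⟨le_rfl, h, fun p hp => by rw [mem_seg] at hp; omega⟩

theorem right (h : a ≤ b) : IsCut σ a b b :=
  ⟨h, le_rfl, fun p _ q hq => by rw [mem_seg] at hq; omega⟩

/-- An intermediate value occurs in `[a, b)`, since that is a common interval; before `m` it would
be too small, from `m'` on too large. -/
theorem isCommonInterval (hS : IsCommonInterval σ (seg n a b)) (hb : b ≤ n)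
    (h : IsCut σ a b m) (h' : IsCut σ a b m') (hlt : m < m') :
    IsCommonInterval σ (seg n m m') := by
  obtain ⟨h1, h2, h3⟩ := h
  obtain ⟨h4, h5, h6⟩ := h'
  rw [isCommonInterval_seg_iff (by omega) hb] at hS
  rw [isCommonInterval_seg_iff hlt (by omega)]
  intro p hp q hq r hpr hrq
  rw [mem_seg] at hp hq
  have hr := hS p ⟨by omega, by omega⟩ q ⟨by omega, by omega⟩ r hpr hrq
  rw [mem_seg] at hr
  rw [mem_seg]
  by_contra hcon
  rcases lt_or_ge r.val m with hrm | hrm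
  · exact lt_asymm hpr (h3 r ⟨hr.1, hrm⟩ p ⟨hp.1, by omega⟩)
  · exact lt_asymm hrq (h6 q ⟨by omega, hq.2⟩ r ⟨by omega, hr.2⟩)

/-- Suppose `p` before `x` had a larger value than some `q` in `[x, m)`. The entry at `m` is above
both, so the value at `p` lies between two values of `[x, y)`, forcing `p` into that common
interval. -/
theorem of_lt_left (h : IsCut σ a b m) (hT : IsCommonInterval σ (seg n x y)) (hy : y ≤ n)
    (hax : a ≤ x) (hyb : y ≤ b) (hxm : x < m) (hmy : m < y) : IsCut σ a b x := by
  obtain ⟨h1, h2, h3⟩ := h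
  rw [isCommonInterval_seg_iff (by omega) hy] at hT
  refine ⟨hax, by omega, fun p hp q hq => ?_⟩
  rw [mem_seg] at hp hq
  rcases lt_or_ge q.val m with hqm | hqm
  · by_contra hcon
    have hne : σ q ≠ σ p := fun e => by
      have := congrArg Fin.val (σ.injective e)
      omega
    have := hT q ⟨by omega, by omega⟩ ⟨m, by omega⟩ ⟨hxm.le, hmy⟩ p
      (lt_of_le_of_ne (not_lt.1 hcon) hne)
      (h3 p ⟨by omega, by omega⟩ ⟨m, by omega⟩ ⟨le_rfl, by dsimp only; omega⟩)
    rw [mem_seg] at this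
    omega
  · exact h3 p ⟨by omega, by omega⟩ q ⟨by omega, by omega⟩

theorem of_lt_right (h : IsCut σ a b m) (hT : IsCommonInterval σ (seg n x y)) (hy : y ≤ n)
    (hax : a ≤ x) (hyb : y ≤ b) (hxm : x < m) (hmy : m < y) : IsCut σ a b y := by
  obtain ⟨h1, h2, h3⟩ := h
  rw [isCommonInterval_seg_iff (by omega) hy] at hT
  refine ⟨by omega, hyb, fun p hp q hq => ?_⟩
  rw [mem_seg] at hp hq
  rcases lt_or_ge p.val m with hpm | hpm
  · exact h3 p ⟨by omega, by omega⟩ q ⟨by omega, by omega⟩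
  · by_contra hcon
    have hne : σ q ≠ σ p := fun e => by
      have := congrArg Fin.val (σ.injective e)
      omega
    have := hT ⟨x, by omega⟩ ⟨le_rfl, by dsimp only; omega⟩ p ⟨by omega, by omega⟩ q
      (h3 ⟨x, by omega⟩ ⟨hax, hxm⟩ q ⟨by omega, by omega⟩)
      (lt_of_le_of_ne (not_lt.1 hcon) hne)
    rw [mem_seg] at this
    omega

/-- A common interval overlapping the slice straddles one of its two ends; its own endpoint inside
the slice would then be a further cut, by `of_lt_left` or `of_lt_right`. -/
theorem isStrongInterval (hS : IsStrongInterval σ (seg n a b)) (hb : b ≤ n)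
    (h : IsCut σ a b m) (h' : IsCut σ a b m') (hlt : m < m')
    (hno : ∀ z, m < z → z < m' → ¬ IsCut σ a b z) : IsStrongInterval σ (seg n m m') := by
  refine ⟨isCommonInterval hS.1 hb h h' hlt, fun T hT hov => ?_⟩
  have hST := hS.2 T hT
  obtain ⟨x, y, hxy, hy, rfl⟩ := hT.exists_seg
  obtain ⟨⟨p, hp, hp'⟩, ⟨q, hq, hq'⟩, ⟨r, hr, hr'⟩⟩ := hov
  have hm := h.1
  have hm' := h'.2.1
  rw [mem_seg] at hp hp' hq hq' hr hr'
  -- Otherwise the overlapping interval would leave `[a, b)` and overlap it too, although `[a, b)`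
  -- is strong.
  have hsub : a ≤ x ∧ y ≤ b := by
    by_contra hcon
    apply hST
    refine ⟨⟨p, ⟨by omega, by omega⟩, by rw [mem_seg]; omega⟩, ?_,
      ⟨r, ⟨by omega, by omega⟩, ⟨by omega, by omega⟩⟩⟩
    by_cases hxa : a ≤ x
    · exact ⟨⟨y - 1, by omega⟩, ⟨by dsimp only; omega, by dsimp only; omega⟩,
        by rw [mem_seg]; dsimp only; omega⟩
    · exact ⟨⟨x, by omega⟩, ⟨le_rfl, hxy⟩, by rw [mem_seg]; dsimp only; omega⟩
  by_cases hxm : x < m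
  · exact hno y (by omega) (by omega) (h.of_lt_right hT hy hsub.1 hsub.2 hxm (by omega))
  · exact hno x (by omega) (by omega) (h'.of_lt_left hT hy hsub.1 hsub.2 (by omega) (by omega))

/-- A cut inside `[x, y)` makes both `[a, m)` and `[m, b)` common intervals, and one of them
overlaps `[x, y)`: the second if `x = a`, the first otherwise. -/
theorem not_mem_strong (hS : IsCommonInterval σ (seg n a b)) (hb : b ≤ n)
    (hT : IsStrongInterval σ (seg n x y)) (hax : a ≤ x) (hyb : y ≤ b) (hne : ¬ (x = a ∧ y = b))
    (hxm : x < m) (hmy : m < y) : ¬ IsCut σ a b m := by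
  intro h
  have hx := h.of_lt_left hT.1 (by omega) hax hyb hxm hmy
  have hy := h.of_lt_right hT.1 (by omega) hax hyb hxm hmy
  by_cases hxa : x = a
  · refine hT.2 _ (isCommonInterval hS hb h (right (by omega)) (by omega))
      ⟨⟨⟨x, by omega⟩, ⟨le_rfl, ?_⟩, ?_⟩, ⟨⟨y, by omega⟩, ⟨?_, ?_⟩, ?_⟩,
        ⟨⟨m, by omega⟩, ⟨?_, ?_⟩, ⟨le_rfl, ?_⟩⟩⟩ <;> (try rw [mem_seg]) <;> dsimp only <;> omega
  · refine hT.2 _ (isCommonInterval hS hb (left (by omega)) h (by omega))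
      ⟨⟨⟨m, by omega⟩, ⟨?_, ?_⟩, ?_⟩, ⟨⟨a, by omega⟩, ⟨le_rfl, ?_⟩, ?_⟩,
        ⟨⟨x, by omega⟩, ⟨le_rfl, ?_⟩, ⟨?_, ?_⟩⟩⟩ <;> (try rw [mem_seg]) <;> dsimp only <;> omega

end IsCut

/-! ## Separable permutations have cuts -/

/-- The segment `[a, b)` has an increasing cut, and the entry at `b` is appended. If its value falls
strictly inside the range of the part before the leftmost such cut, minimality of the cut produces
3142. -/
theorem exists_cut_step {n : ℕ} {α : Type*} [LinearOrder α] (f : Fin n → α)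
    (hf : Function.Injective f)
    (h3142 : ∀ i j k l : Fin n, i < j → j < k → k < l → f j < f l → f l < f i → ¬ f i < f k)
    {a b : ℕ} (hb : b < n)
    (ih : ∀ m, a + 2 ≤ m → m ≤ b → ∃ z, a < z ∧ z < m ∧
      ((∀ p ∈ seg n a z, ∀ q ∈ seg n z m, f p < f q) ∨
        ∀ p ∈ seg n a z, ∀ q ∈ seg n z m, f q < f p))
    (h : ∃ z, a < z ∧ z < b ∧ ∀ p ∈ seg n a z, ∀ q ∈ seg n z b, f p < f q) :
    ∃ z, a < z ∧ z < b + 1 ∧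
      ((∀ p ∈ seg n a z, ∀ q ∈ seg n z (b + 1), f p < f q) ∨
        ∀ p ∈ seg n a z, ∀ q ∈ seg n z (b + 1), f q < f p) := by
  classical
  set m := Nat.find h with hm
  obtain ⟨ham, hmb, hcut⟩ := Nat.find_spec h
  rw [← hm] at ham hmb hcut
  have hmin : ∀ z, z < m → ¬ _ := fun z hz => Nat.find_min h hz
  set x : Fin n := ⟨b, hb⟩ with hx
  by_cases h1 : ∀ p ∈ seg n a m, f p < f x
  · refine ⟨m, ham, by omega, Or.inl fun p hp q hq => ?_⟩
    rw [mem_seg] at hq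
    by_cases hqb : q.val = b
    · rw [show q = x from Fin.ext hqb]
      exact h1 p hp
    · exact hcut p hp q ⟨hq.1, by omega⟩
  by_cases h2 : ∀ p ∈ seg n a m, f x < f p
  · refine ⟨b, by omega, by omega, Or.inr fun p hp q hq => ?_⟩
    rw [mem_seg] at hq hp
    rw [show q = x from Fin.ext (by simp only [hx]; omega)]
    by_cases hpm : p.val < m
    · exact h2 p ⟨hp.1, hpm⟩
    · have ha : (⟨a, by omega⟩ : Fin n) ∈ seg n a m := ⟨le_rfl, ham⟩
      exact (h2 _ ha).trans (hcut _ ha p ⟨by omega, hp.2⟩)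
  exfalso
  push Not at h1 h2
  obtain ⟨u, hu, hux⟩ := h1
  obtain ⟨v, hv, hvx⟩ := h2
  rw [mem_seg] at hu hv
  have hnx : ∀ w : Fin n, w.val < m → f w ≠ f x := fun w hw e => by
    have := congrArg Fin.val (hf e)
    simp only [hx] at this
    omega
  have hux' : f x < f u := lt_of_le_of_ne hux (hnx u hu.2).symm
  have hvx' : f v < f x := lt_of_le_of_ne hvx (hnx v hv.2)
  have huv : u.val ≠ v.val := fun e => by
    rw [Fin.ext e] at hux'
    exact lt_asymm hux' hvx'
  -- The distinct positions `u` and `v` show that `[a, m)` has at least two entries. An increasing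
  -- cut of it would also cut `[a, b)`, to the left of `m`.
  obtain ⟨z, haz, hzm, hz⟩ := ih m (by omega) hmb.le
  rcases hz with hz | hz
  · refine hmin z hzm ⟨haz, by omega, fun p hp q hq => ?_⟩
    rw [mem_seg] at hq
    by_cases hqm : q.val < m
    · exact hz p hp q ⟨hq.1, hqm⟩
    · rw [mem_seg] at hp
      exact hcut p ⟨hp.1, by omega⟩ q ⟨by omega, hq.2⟩
  · have hp : ∃ p ∈ seg n a z, f x < f p := by
      by_cases huz : u.val < z
      · exact ⟨u, ⟨hu.1, huz⟩, hux'⟩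
      · exact ⟨⟨a, by omega⟩, ⟨le_rfl, haz⟩,
          hux'.trans (hz ⟨a, by omega⟩ ⟨le_rfl, haz⟩ u ⟨by omega, hu.2⟩)⟩
    have hq : ∃ q ∈ seg n z m, f q < f x := by
      by_cases hvz : v.val < z
      · exact ⟨⟨z, by omega⟩, ⟨le_rfl, hzm⟩,
          (hz v ⟨hv.1, hvz⟩ ⟨z, by omega⟩ ⟨le_rfl, hzm⟩).trans hvx'⟩
      · exact ⟨v, ⟨by omega, hv.2⟩, hvx'⟩
    obtain ⟨p, hp, hpx⟩ := hp
    obtain ⟨q, hq, hqx⟩ := hq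
    rw [mem_seg] at hp hq
    -- With a decreasing cut `z` of `[a, m)`, the entries at `p < z ≤ q < m < b` read 3, 1, 4, 2.
    refine h3142 p q ⟨m, by omega⟩ x ?_ ?_ ?_ hqx hpx
      (hcut p ⟨hp.1, by omega⟩ _ ⟨le_rfl, hmb⟩) <;> rw [Fin.lt_def] <;> (try dsimp only [x]) <;> omega

/-- Removing the last entry leaves a segment with a cut. A decreasing one is handled in the dual
order, where 3142 and 2413 change places. -/
theorem exists_cut_of_avoids {n : ℕ} {α : Type*} [LinearOrder α] (f : Fin n → α)
    (hf : Function.Injective f)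
    (h3142 : ∀ i j k l : Fin n, i < j → j < k → k < l → f j < f l → f l < f i → ¬ f i < f k)
    (h2413 : ∀ i j k l : Fin n, i < j → j < k → k < l → f k < f i → f i < f l → ¬ f l < f j)
    (a b : ℕ) (hb : b ≤ n) (hab : a + 2 ≤ b) :
    ∃ z, a < z ∧ z < b ∧
      ((∀ p ∈ seg n a z, ∀ q ∈ seg n z b, f p < f q) ∨
        ∀ p ∈ seg n a z, ∀ q ∈ seg n z b, f q < f p) := by
  induction b using Nat.strong_induction_on with
  | _ b ih =>
  obtain ⟨b, rfl⟩ : ∃ b', b = b' + 1 := ⟨b - 1, by omega⟩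
  have ih' : ∀ m, a + 2 ≤ m → m ≤ b → ∃ z, a < z ∧ z < m ∧
      ((∀ p ∈ seg n a z, ∀ q ∈ seg n z m, f p < f q) ∨
        ∀ p ∈ seg n a z, ∀ q ∈ seg n z m, f q < f p) :=
    fun m h1 h2 => ih m (by omega) (by omega) h1
  by_cases hab' : a + 2 ≤ b
  · obtain ⟨z, haz, hzb, hz | hz⟩ := ih' b hab' le_rfl
    · exact exists_cut_step f hf h3142 hb ih' ⟨z, haz, hzb, hz⟩
    · obtain ⟨w, haw, hwb, hw⟩ := exists_cut_step (α := αᵒᵈ) (fun p => OrderDual.toDual (f p))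
        (fun p q e => hf e)
        (fun i j k l h1 h2 h3 h4 h5 h6 => h2413 i j k l h1 h2 h3 h6 h5 h4) hb
        (fun m h1 h2 => by
          obtain ⟨w, h3, h4, h5⟩ := ih' m h1 h2
          exact ⟨w, h3, h4, h5.symm⟩) ⟨z, haz, hzb, hz⟩
      exact ⟨w, haw, hwb, hw.symm⟩
  · have hba : b = a + 1 := by omega
    subst hba
    refine ⟨a + 1, by omega, by omega, ?_⟩
    have hp : ∀ p ∈ seg n a (a + 1), p = ⟨a, by omega⟩ := fun p hp => by
      rw [mem_seg] at hp
      exact Fin.ext (by dsimp only; omega)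
    have hq : ∀ p ∈ seg n (a + 1) (a + 1 + 1), p = ⟨a + 1, by omega⟩ := fun p hp => by
      rw [mem_seg] at hp
      exact Fin.ext (by dsimp only; omega)
    rcases lt_trichotomy (f ⟨a, by omega⟩) (f ⟨a + 1, by omega⟩) with h | h | h
    · exact Or.inl fun p hp' q hq' => by rw [hp p hp', hq q hq']; exact h
    · have := congrArg Fin.val (hf h)
      dsimp only at this
      omega
    · exact Or.inr fun p hp' q hq' => by rw [hp p hp', hq q hq']; exact h

theorem strictMono_vec4 {n : ℕ} {i j k l : Fin n} (h1 : i < j) (h2 : j < k) (h3 : k < l) :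
    StrictMono ![i, j, k, l] := by
  rw [Fin.strictMono_iff_lt_succ]
  intro m
  fin_cases m
  · exact h1
  · exact h2
  · exact h3

theorem IsSeparablePerm.exists_isCut {n : ℕ} {σ : Equiv.Perm (Fin n)} (hσ : IsSeparablePerm σ)
    {a b : ℕ} (hb : b ≤ n) (hab : a + 2 ≤ b) :
    ∃ s m, a < m ∧ m < b ∧ IsCut (orient s σ) a b m := by
  obtain ⟨z, haz, hzb, hz | hz⟩ := exists_cut_of_avoids σ σ.injective
    (fun i j k l h1 h2 h3 h4 h5 h6 => hσ.1 ⟨![i, j, k, l], strictMono_vec4 h1 h2 h3, by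
      have h7 := h4.trans h5
      have h8 := h5.trans h6
      have h9 := h7.trans h6
      intro u v
      fin_cases u <;> fin_cases v <;> simp [perm3142, *]⟩)
    (fun i j k l h1 h2 h3 h4 h5 h6 => hσ.2 ⟨![i, j, k, l], strictMono_vec4 h1 h2 h3, by
      have h7 := h4.trans h5
      have h8 := h5.trans h6
      have h9 := h7.trans h6
      intro u v
      fin_cases u <;> fin_cases v <;> simp [perm2413, *]⟩) a b hb hab
  · exact ⟨.plus, z, haz, hzb, haz.le, hzb.le, hz⟩
  · exact ⟨.minus, z, haz, hzb, haz.le, hzb.le, fun p hp q hq => by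
      rw [orient_minus_apply, orient_minus_apply, Fin.rev_lt_rev]
      exact hz p hp q hq⟩

/-- A cut splits the whole into two common intervals; as `k ≥ 3`, one of them is neither a singleton
nor everything. -/
theorem IsSeparablePerm.not_isSimplePerm {k : ℕ} {π : Equiv.Perm (Fin k)}
    (hπ : IsSeparablePerm π) (hk : 3 ≤ k) : ¬ IsSimplePerm π := by
  intro hs
  obtain ⟨s, m, h0, hm, hcut⟩ := hπ.exists_isCut (a := 0) le_rfl (by omega)
  have hu : seg k 0 k = Set.univ := Set.eq_univ_of_forall fun p => ⟨Nat.zero_le _, p.isLt⟩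
  have hS : IsCommonInterval (orient s π) (seg k 0 k) := by
    rw [hu]
    exact isCommonInterval_univ (by omega) _
  by_cases h1 : m = 1
  · rcases hs _ ((isCommonInterval_orient s π _).1
      (IsCut.isCommonInterval hS le_rfl hcut (IsCut.right (by omega)) hm)) with h | ⟨i, h⟩
    · have : (⟨0, by omega⟩ : Fin k) ∈ seg k m k := h ▸ Set.mem_univ _
      rw [mem_seg] at this
      dsimp only at this
      omega
    · have h2 : (⟨1, by omega⟩ : Fin k) ∈ seg k m k := ⟨by dsimp only; omega, by dsimp only; omega⟩
      have h3 : (⟨2, by omega⟩ : Fin k) ∈ seg k m k := ⟨by dsimp only; omega, by dsimp only; omega⟩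
      rw [h, Set.mem_singleton_iff] at h2 h3
      have := congrArg Fin.val (h2.trans h3.symm)
      dsimp only at this
      omega
  · rcases hs _ ((isCommonInterval_orient s π _).1
      (IsCut.isCommonInterval hS le_rfl (IsCut.left (by omega)) hcut h0)) with h | ⟨i, h⟩
    · have : (⟨m, by omega⟩ : Fin k) ∈ seg k 0 m := h ▸ Set.mem_univ _
      rw [mem_seg] at this
      dsimp only at this
      omega
    · have h2 : (⟨0, by omega⟩ : Fin k) ∈ seg k 0 m := ⟨by dsimp only; omega, by dsimp only; omega⟩
      have h3 : (⟨1, by omega⟩ : Fin k) ∈ seg k 0 m := ⟨by dsimp only; omega, by dsimp only; omega⟩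
      rw [h, Set.mem_singleton_iff] at h2 h3
      have := congrArg Fin.val (h2.trans h3.symm)
      dsimp only at this
      omega

namespace DecompTree

/-! ## Positions of the children of a node -/

theorem start_zero {k : ℕ} (c : Fin (k + 1) → DecompTree) (a : ℕ) : start c a 0 = a := by
  have : Finset.Iio (0 : Fin (k + 1)) = ∅ := by
    ext j
    simp
  rw [start, this, Finset.sum_empty, add_zero]

/-- A sum over the full index set can be split at its first or last term, which gives the shift
lemmas below. -/
theorem start_eq_sum_ite {k : ℕ} (c : Fin k → DecompTree) (a : ℕ) (i : Fin k) :
    start c a i = a + ∑ j, if j < i then (c j).numLeaves else 0 := by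
  rw [start, ← Finset.sum_filter]
  congr 2
  ext j
  simp

theorem start_succ {k : ℕ} (c : Fin (k + 1) → DecompTree) (a : ℕ) (i : Fin k) :
    start c a i.succ = start (fun j => c j.succ) (a + (c 0).numLeaves) i := by
  rw [start_eq_sum_ite, start_eq_sum_ite, Fin.sum_univ_succ]
  simp [add_assoc]

theorem start_castSucc {k : ℕ} (c : Fin (k + 1) → DecompTree) (a : ℕ) (i : Fin k) :
    start c a i.castSucc = start (fun j => c j.castSucc) a i := by
  rw [start_eq_sum_ite, start_eq_sum_ite, Fin.sum_univ_castSucc]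
  simp [Fin.castSucc_lt_castSucc_iff, Fin.le_last, not_lt]

theorem start_last {k : ℕ} (c : Fin (k + 1) → DecompTree) (a : ℕ) :
    start c a (Fin.last k) = a + ∑ i : Fin k, (c i.castSucc).numLeaves := by
  rw [start_eq_sum_ite, Fin.sum_univ_castSucc]
  simp [Fin.castSucc_lt_last]

theorem le_start {k : ℕ} (c : Fin k → DecompTree) (a : ℕ) (i : Fin k) : a ≤ start c a i :=
  Nat.le_add_right _ _

theorem start_add_numLeaves {k : ℕ} (c : Fin k → DecompTree) (a : ℕ) (i : Fin k) :
    start c a i + (c i).numLeaves = a + ∑ j ∈ Finset.Iic i, (c j).numLeaves := by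
  rw [start, add_assoc, ← Finset.Iio_insert, Finset.sum_insert (by simp), add_comm (numLeaves _)]

theorem start_add_le_start {k : ℕ} (c : Fin k → DecompTree) (a : ℕ) {i j : Fin k} (h : i < j) :
    start c a i + (c i).numLeaves ≤ start c a j := by
  rw [start_add_numLeaves, start]
  refine Nat.add_le_add_left (Finset.sum_le_sum_of_subset fun m hm => ?_) a
  rw [Finset.mem_Iic] at hm
  exact Finset.mem_Iio.2 (hm.trans_lt h)

theorem start_add_le_sum {k : ℕ} (c : Fin k → DecompTree) (a : ℕ) (i : Fin k) :
    start c a i + (c i).numLeaves ≤ a + ∑ j, (c j).numLeaves := by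
  rw [start_add_numLeaves]
  exact Nat.add_le_add_left (Finset.sum_le_sum_of_subset (Finset.subset_univ _)) a

theorem start_mono {k : ℕ} (c : Fin k → DecompTree) (a : ℕ) {i j : Fin k} (h : i ≤ j) :
    start c a i ≤ start c a j := by
  rcases h.eq_or_lt with rfl | h
  · rfl
  · exact (Nat.le_add_right _ _).trans (start_add_le_start c a h)

theorem exists_start_le_lt {k : ℕ} (c : Fin k → DecompTree) (a : ℕ) {p : ℕ} (h1 : a ≤ p)
    (h2 : p < a + ∑ i, (c i).numLeaves) :
    ∃ i, start c a i ≤ p ∧ p < start c a i + (c i).numLeaves := by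
  induction k generalizing a with
  | zero =>
    simp at h2
    omega
  | succ k ih =>
    by_cases hp : p < a + (c 0).numLeaves
    · exact ⟨0, by rwa [start_zero], by rwa [start_zero]⟩
    · rw [Fin.sum_univ_succ] at h2
      obtain ⟨i, h3, h4⟩ := ih (fun j => c j.succ) (a + (c 0).numLeaves) (by omega) (by omega)
      exact ⟨i.succ, by rwa [start_succ], by rwa [start_succ]⟩

theorem childUnion_eq_seg (n : ℕ) {k : ℕ} (c : Fin k → DecompTree) (a : ℕ) {i j : Fin k}
    (hij : i ≤ j) :
    childUnion n c a i j = seg n (start c a i) (start c a j + (c j).numLeaves) := by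
  ext p
  simp only [childUnion, Set.mem_iUnion, childBlock, mem_block, Set.mem_Icc, mem_seg, exists_prop]
  constructor
  · rintro ⟨m, ⟨h1, h2⟩, h3, h4⟩
    refine ⟨(start_mono c a h1).trans h3, ?_⟩
    rcases h2.eq_or_lt with rfl | h2
    · exact h4
    · have := start_add_le_start c a h2
      omega
  · rintro ⟨h1, h2⟩
    obtain ⟨m, h3, h4⟩ := exists_start_le_lt c a ((le_start c a i).trans h1)
      (h2.trans_le (start_add_le_sum c a j))
    refine ⟨m, ⟨?_, ?_⟩, h3, h4⟩
    · by_contra hcon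
      have := start_add_le_start c a (not_le.1 hcon)
      omega
    · by_contra hcon
      have := start_add_le_start c a (not_le.1 hcon)
      omega

theorem Branching.numLeaves_pos : ∀ {T : DecompTree}, T.Branching → 0 < T.numLeaves
  | leaf, _ => Nat.one_pos
  | linear _ k c, h => by
    have h0 := (h.2 ⟨0, by have := h.1; omega⟩).numLeaves_pos
    exact h0.trans_le (Finset.single_le_sum (f := fun i => (c i).numLeaves)
      (fun _ _ => Nat.zero_le _) (Finset.mem_univ _))
  | prime k _ c, h => by
    have h0 := (h.2 ⟨0, by have := h.1; omega⟩).numLeaves_pos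
    exact h0.trans_le (Finset.single_le_sum (f := fun i => (c i).numLeaves)
      (fun _ _ => Nat.zero_le _) (Finset.mem_univ _))

theorem numLeaves_lt_sum {k : ℕ} {c : Fin k → DecompTree} (hk : 2 ≤ k)
    (hc : ∀ i, 0 < (c i).numLeaves) (i : Fin k) :
    (c i).numLeaves < ∑ j, (c j).numLeaves := by
  obtain ⟨j, hj⟩ : ∃ j : Fin k, j ≠ i := by
    by_cases h : i.val = 0
    · exact ⟨⟨1, by omega⟩, fun e => by rw [← e] at h; simp at h⟩
    · exact ⟨⟨0, by omega⟩, fun e => h (by rw [← e])⟩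
  exact Finset.single_lt_sum (f := fun j => (c j).numLeaves) hj (Finset.mem_univ i) (Finset.mem_univ j) (hc j)
    fun _ _ _ => Nat.zero_le _

theorem self_mem_nodeBlocks (n : ℕ) (T : DecompTree) (a : ℕ) :
    block n a T.numLeaves ∈ T.nodeBlocks n a := by
  cases T with
  | leaf => exact Set.mem_singleton _
  | linear s k c => exact Or.inl rfl
  | prime k π c => exact Or.inl rfl

theorem childBlock_subset_block (n : ℕ) {k : ℕ} (c : Fin k → DecompTree) (a : ℕ) (i : Fin k) :
    childBlock n c a i ⊆ block n a (∑ j, (c j).numLeaves) := fun p hp => by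
  have h1 := le_start c a i
  have h2 := start_add_le_sum c a i
  rw [childBlock, mem_block] at hp
  rw [mem_block]
  omega

theorem Branching.block_nonempty {n : ℕ} {T : DecompTree} (hT : T.Branching) {a : ℕ}
    (ha : a + T.numLeaves ≤ n) : (block n a T.numLeaves).Nonempty := by
  have := hT.numLeaves_pos
  exact ⟨⟨a, by omega⟩, le_rfl, by dsimp only; omega⟩

theorem mem_nodeBlocks {n : ℕ} {T : DecompTree} (hT : T.Branching) {a : ℕ}
    (ha : a + T.numLeaves ≤ n) {S : Set (Fin n)} (hS : S ∈ T.nodeBlocks n a) :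
    S ⊆ block n a T.numLeaves ∧ S.Nonempty := by
  induction T generalizing a with
  | leaf =>
    rw [Set.mem_singleton_iff.1 hS]
    exact ⟨subset_rfl, Branching.block_nonempty (T := leaf) trivial ha⟩
  | linear s k c ih =>
    rcases hS with hS | hS
    · rw [Set.mem_singleton_iff.1 hS]
      exact ⟨subset_rfl, hT.block_nonempty ha⟩
    · obtain ⟨i, hi⟩ := Set.mem_iUnion.1 hS
      obtain ⟨h1, h2⟩ := ih i (hT.2 i) ((start_add_le_sum c a i).trans ha) hi
      exact ⟨h1.trans (childBlock_subset_block n c a i), h2⟩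
  | prime k π c ih =>
    rcases hS with hS | hS
    · rw [Set.mem_singleton_iff.1 hS]
      exact ⟨subset_rfl, hT.block_nonempty ha⟩
    · obtain ⟨i, hi⟩ := Set.mem_iUnion.1 hS
      obtain ⟨h1, h2⟩ := ih i (hT.2 i) ((start_add_le_sum c a i).trans ha) hi
      exact ⟨h1.trans (childBlock_subset_block n c a i), h2⟩

theorem signCorrect_iff_orient {n : ℕ} (σ : Equiv.Perm (Fin n)) (s : NodeSign) {k : ℕ}
    (V : Fin k → Set (Fin n)) :
    SignCorrect σ s V ↔ ∀ i j : Fin k, i < j → ValuesBelow (orient s σ) (V i) (V j) := by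
  cases s with
  | plus => rfl
  | minus =>
    simp only [SignCorrect, ValuesBelow, orient_minus_apply, Fin.rev_lt_rev]
    exact ⟨fun h i j hij p hp q hq => h i j hij q hq p hp,
      fun h i j hij p hp q hq => h i j hij q hq p hp⟩

/-! ## Existence -/

/-- Abstract slicing: `C` stands for "is a cut" and `Q` for what recursion supplies on each slice.
The last clause places any segment without interior cut in a single slice. -/
theorem exists_forest (C : ℕ → Prop) (Q : DecompTree → ℕ → Prop) {b : ℕ} (hb : C b)
    (hT : ∀ m m', C m → C m' → m < m' → m' ≤ b → (∀ x, m < x → x < m' → ¬ C x) →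
      ∃ T : DecompTree, m + T.numLeaves = m' ∧ Q T m) (d : ℕ) :
    ∀ m, m + d = b → C m → ∃ (k : ℕ) (c : Fin k → DecompTree),
      m + ∑ i, (c i).numLeaves = b ∧
      (∀ i, C (start c m i) ∧ C (start c m i + (c i).numLeaves) ∧ Q (c i) (start c m i)) ∧
      ∀ x y, m ≤ x → x < y → y ≤ b → (∀ z, x < z → z < y → ¬ C z) →
        ∃ i, start c m i ≤ x ∧ y ≤ start c m i + (c i).numLeaves := by
  classical
  induction d using Nat.strong_induction_on with
  | _ d ih =>
  intro m hm hCm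
  rcases Nat.eq_zero_or_pos d with rfl | hd
  · exact ⟨0, Fin.elim0, by simpa using hm, fun i => i.elim0, fun x y h1 h2 h3 => by omega⟩
  have hex : ∃ m', m < m' ∧ C m' := ⟨b, by omega, hb⟩
  obtain ⟨hlt, hC'⟩ := Nat.find_spec hex
  have hle : Nat.find hex ≤ b := Nat.find_min' hex ⟨by omega, hb⟩
  have hno : ∀ x, m < x → x < Nat.find hex → ¬ C x := fun x h1 h2 h3 =>
    Nat.find_min hex h2 ⟨h1, h3⟩
  generalize Nat.find hex = m' at hlt hC' hle hno
  obtain ⟨T, rfl, hQ⟩ := hT m m' hCm hC' hlt hle hno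
  obtain ⟨k, c, hsum, hc, hcov⟩ :=
    ih (b - (m + T.numLeaves)) (by omega) (m + T.numLeaves) (by omega) hC'
  refine ⟨k + 1, Fin.cons T c, ?_, ?_, ?_⟩
  · rw [Fin.sum_univ_succ]
    simp only [Fin.cons_zero, Fin.cons_succ]
    omega
  · intro i
    induction i using Fin.cases with
    | zero =>
      rw [start_zero]
      exact ⟨hCm, hC', hQ⟩
    | succ i =>
      rw [start_succ]
      exact hc i
  · intro x y h1 h2 h3 h4
    by_cases hx : x < m + T.numLeaves
    · refine ⟨0, by rwa [start_zero], ?_⟩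
      rw [start_zero]
      by_contra hcon
      exact h4 _ hx (not_le.1 hcon) hC'
    · obtain ⟨i, h5, h6⟩ := hcov x y (not_lt.1 hx) h2 h3 h4
      exact ⟨i.succ, by rwa [start_succ], by rw [start_succ]; exact h6⟩

theorem exists_tree {n : ℕ} {σ : Equiv.Perm (Fin n)} (hσ : IsSeparablePerm σ) (l : ℕ) :
    ∀ a, a + l ≤ n → IsStrongInterval σ (block n a l) → ∃ T : DecompTree,
      T.numLeaves = l ∧ T.Branching ∧ T.LabelsCorrect σ a ∧
      ∀ S, S ∈ T.nodeBlocks n a ↔ IsStrongInterval σ S ∧ S ⊆ block n a l := by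
  induction l using Nat.strong_induction_on with
  | _ l ih =>
  intro a ha hS
  obtain rfl | rfl | hl : l = 0 ∨ l = 1 ∨ 2 ≤ l := by omega
  · obtain ⟨p, hp⟩ := hS.1.1
    rw [mem_block] at hp
    omega
  · refine ⟨leaf, rfl, trivial, trivial, fun S => ?_⟩
    simp only [nodeBlocks, Set.mem_singleton_iff]
    constructor
    · rintro rfl
      exact ⟨hS, subset_rfl⟩
    · rintro ⟨h1, h2⟩
      obtain ⟨x, y, hxy, hy, rfl⟩ := h1.1.exists_seg
      rw [block_subset_iff hxy hy] at h2
      rw [block_eq_seg, show x = a by omega, show y = a + 1 by omega]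
  obtain ⟨s, m, ham, hmb, hcut⟩ := hσ.exists_isCut ha (by omega : a + 2 ≤ a + l)
  set b := a + l with hb
  rw [block_eq_seg, ← hb] at hS ⊢
  have hτ := (isStrongInterval_orient s σ _).2 hS
  set τ := orient s σ with hτdef
  obtain ⟨k, c, hsum, hc, hcov⟩ := exists_forest (IsCut τ a b)
    (fun T m => T.Branching ∧ T.LabelsCorrect σ m ∧
      (∀ S, S ∈ T.nodeBlocks n m ↔ IsStrongInterval σ S ∧ S ⊆ block n m T.numLeaves) ∧
      ∀ z, m < z → z < m + T.numLeaves → ¬ IsCut τ a b z)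
    (IsCut.right (by omega)) (fun x y hx hy hxy hyb hno => by
      have hst := IsCut.isStrongInterval hτ ha hx hy hxy hno
      rw [isStrongInterval_orient] at hst
      have hax := hx.1
      -- A slice of full length would contain the interior cut `m`; this makes the recursion
      -- decrease.
      have hlt : y - x < l := by
        by_contra hcon
        exact hno m (by omega) (by omega) hcut
      obtain ⟨d, rfl⟩ : ∃ d, y = x + d := ⟨y - x, by omega⟩
      obtain ⟨T, h1, h2, h3, h4⟩ := ih d (by omega) x (by omega) hst
      subst h1
      exact ⟨T, rfl, h2, h3, h4, hno⟩) l a rfl (IsCut.left (by omega))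
  have hsum' : ∑ i, (c i).numLeaves = l := by omega
  have hpos : ∀ i, 0 < (c i).numLeaves := fun i => (hc i).2.2.1.numLeaves_pos
  have hk : 2 ≤ k := by
    obtain rfl | rfl | hk : k = 0 ∨ k = 1 ∨ 2 ≤ k := by omega
    · simp at hsum'
      omega
    -- A single child would be all of `[a, b)` and again have `m` inside.
    · have := (hc 0).2.2.2.2.2 m
      rw [start_zero] at this
      simp at hsum'
      rw [hsum'] at this
      exact absurd hcut (this ham hmb)
    · exact hk
  have hend : ∀ i, start c a i + (c i).numLeaves ≤ b := fun i => by
    have := start_add_le_sum c a i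
    omega
  refine ⟨linear s k c, hsum', ⟨hk, fun i => (hc i).2.2.1⟩, ⟨?_, ?_, fun i => (hc i).2.2.2.1⟩, ?_⟩
  · intro i j hij
    rw [childUnion_eq_seg n c a hij, ← isCommonInterval_orient s]
    refine IsCut.isCommonInterval hτ.1 ha (hc i).1 (hc j).2.1 ?_
    have h1 := start_mono c a hij
    have h2 := hpos j
    omega
  · rw [signCorrect_iff_orient]
    intro i j hij p hp q hq
    have h1 := start_add_le_start c a hij
    have h2 := le_start c a i
    have h3 := hend j
    rw [childBlock, mem_block] at hp hq
    exact (hc j).1.2.2 p ⟨by omega, by omega⟩ q ⟨by omega, by omega⟩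
  · intro S
    have hroot : block n a (linear s k c).numLeaves = seg n a b := by
      rw [block_eq_seg]
      exact congrArg _ hsum
    simp only [nodeBlocks, Set.mem_union, Set.mem_singleton_iff, Set.mem_iUnion, hroot]
    constructor
    · rintro (rfl | ⟨i, hi⟩)
      · exact ⟨hS, subset_rfl⟩
      · obtain ⟨h1, h2⟩ := ((hc i).2.2.2.2.1 S).1 hi
        refine ⟨h1, fun p hp => ?_⟩
        have h3 := h2 hp
        have h4 := le_start c a i
        have h5 := hend i
        rw [mem_block] at h3
        exact ⟨by omega, by omega⟩
    · rintro ⟨h1, h2⟩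
      obtain ⟨x, y, hxy, hy, rfl⟩ := h1.1.exists_seg
      have h3 : a ≤ x ∧ y ≤ b := (block_subset_iff hxy hy).1 h2
      by_cases hne : x = a ∧ y = b
      · exact Or.inl (by rw [hne.1, hne.2])
      · obtain ⟨i, hi⟩ := hcov x y h3.1 hxy h3.2 fun z h4 h5 =>
          IsCut.not_mem_strong hτ.1 ha ((isStrongInterval_orient s σ _).2 h1) h3.1 h3.2 hne h4 h5
        exact Or.inr ⟨i, ((hc i).2.2.2.2.1 _).2 ⟨h1, (block_subset_iff hxy hy).2 hi⟩⟩

end DecompTree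

namespace DecompTree

/-! ## Separable permutations have no prime nodes -/

/-- No node is prime. -/
def AllLinear : DecompTree → Prop
  | leaf => True
  | linear _ _ c => ∀ i, (c i).AllLinear
  | prime _ _ _ => False

/-- The first leaf of each child serves as its representative: order between children passes to
these entries. -/
theorem containsPattern_of_children {n k j : ℕ} {σ : Equiv.Perm (Fin n)} {π : Equiv.Perm (Fin k)}
    {ρ : Equiv.Perm (Fin j)} {c : Fin k → DecompTree} {a : ℕ}
    (hpos : ∀ i, 0 < (c i).numLeaves) (ha : a + ∑ i, (c i).numLeaves ≤ n)
    (hπ : ∀ i j, π i < π j → ValuesBelow σ (childBlock n c a i) (childBlock n c a j))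
    (h : ContainsPattern π ρ) : ContainsPattern σ ρ := by
  obtain ⟨f, hf, hρ⟩ := h
  have hlt : ∀ i, start c a i < n := fun i => by
    have h1 := start_add_le_sum c a i
    have h2 := hpos i
    omega
  have hmem : ∀ i, (⟨start c a i, hlt i⟩ : Fin n) ∈ childBlock n c a i := fun i =>
    ⟨le_rfl, Nat.lt_add_of_pos_right (hpos i)⟩
  refine ⟨fun i => ⟨start c a (f i), hlt _⟩, fun i i' hi => ?_, fun l m hlm => ?_⟩
  · rw [Fin.lt_def]
    have h1 := start_add_le_start c a (hf hi)
    have h2 := hpos (f i)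
    dsimp only
    omega
  · exact hπ _ _ (hρ l m hlm) _ (hmem _) _ (hmem _)

theorem allLinear_of_labelsCorrect {n : ℕ} {σ : Equiv.Perm (Fin n)} (hσ : IsSeparablePerm σ)
    {T : DecompTree} (hT : T.Branching) {a : ℕ} (ha : a + T.numLeaves ≤ n)
    (hL : T.LabelsCorrect σ a) : T.AllLinear := by
  induction T generalizing a with
  | leaf => trivial
  | linear s k c ih =>
    exact fun i => ih i (hT.2 i) ((start_add_le_sum c a i).trans ha) (hL.2.2 i)
  | prime k π c ih =>
    obtain ⟨hk2, -, hsimple, hπ, -⟩ := hL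
    have hk := hT.1
    have hpos : ∀ i, 0 < (c i).numLeaves := fun i => (hT.2 i).numLeaves_pos
    refine IsSeparablePerm.not_isSimplePerm (π := π) ⟨fun h => hσ.1 ?_, fun h => hσ.2 ?_⟩
      (by omega) hsimple
    · exact containsPattern_of_children hpos ha (fun i j => (hπ i j).1) h
    · exact containsPattern_of_children hpos ha (fun i j => (hπ i j).1) h

/-! ## Uniqueness -/

/-- The blocks of the nodes of the subtrees in the list `c`. -/
def forestBlocks (n : ℕ) {k : ℕ} (c : Fin k → DecompTree) (a : ℕ) : Set (Set (Fin n)) :=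
  ⋃ i, (c i).nodeBlocks n (start c a i)

theorem forestBlocks_succ (n : ℕ) {k : ℕ} (c : Fin (k + 1) → DecompTree) (a : ℕ) :
    forestBlocks n c a = (c 0).nodeBlocks n a ∪
      forestBlocks n (fun i => c i.succ) (a + (c 0).numLeaves) := by
  ext S
  simp only [forestBlocks, Set.mem_iUnion, Set.mem_union, Fin.exists_fin_succ, start_zero,
    start_succ]

theorem mem_forestBlocks {n : ℕ} {k : ℕ} {c : Fin k → DecompTree} (hc : ∀ i, (c i).Branching)
    {a : ℕ} (ha : a + ∑ i, (c i).numLeaves ≤ n) {S : Set (Fin n)}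
    (hS : S ∈ forestBlocks n c a) : (∀ p ∈ S, a ≤ p.val) ∧ S.Nonempty := by
  obtain ⟨i, hi⟩ := Set.mem_iUnion.1 hS
  obtain ⟨h1, h2⟩ := mem_nodeBlocks (hc i) ((start_add_le_sum c a i).trans ha) hi
  exact ⟨fun p hp => (le_start c a i).trans (h1 hp).1, h2⟩

theorem mem_nodeBlocks_zero_iff {n : ℕ} {k : ℕ} {c : Fin (k + 1) → DecompTree}
    (hc : ∀ i, (c i).Branching) {a : ℕ} (ha : a + ∑ i, (c i).numLeaves ≤ n) (S : Set (Fin n)) :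
    S ∈ (c 0).nodeBlocks n a ↔ S ∈ forestBlocks n c a ∧ S ⊆ block n a (c 0).numLeaves := by
  rw [Fin.sum_univ_succ] at ha
  rw [forestBlocks_succ]
  constructor
  · intro h
    exact ⟨Or.inl h, (mem_nodeBlocks (hc 0) (by omega) h).1⟩
  · rintro ⟨h | h, h'⟩
    · exact h
    · obtain ⟨h1, p, hp⟩ := mem_forestBlocks (fun i => hc i.succ) (by omega) h
      have h2 := h1 p hp
      have h3 := h' hp
      rw [mem_block] at h3
      omega

theorem mem_forestBlocks_tail_iff {n : ℕ} {k : ℕ} {c : Fin (k + 1) → DecompTree}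
    (hc : ∀ i, (c i).Branching) {a : ℕ} (ha : a + ∑ i, (c i).numLeaves ≤ n) (S : Set (Fin n)) :
    S ∈ forestBlocks n (fun i => c i.succ) (a + (c 0).numLeaves) ↔
      S ∈ forestBlocks n c a ∧ ¬ S ⊆ block n a (c 0).numLeaves := by
  rw [Fin.sum_univ_succ] at ha
  rw [forestBlocks_succ]
  constructor
  · intro h
    refine ⟨Or.inr h, fun h' => ?_⟩
    obtain ⟨h1, p, hp⟩ := mem_forestBlocks (fun i => hc i.succ) (by omega) h
    have h2 := h1 p hp
    have h3 := h' hp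
    rw [mem_block] at h3
    omega
  · rintro ⟨h | h, h'⟩
    · exact absurd (mem_nodeBlocks (hc 0) (by omega) h).1 h'
    · exact h

/-- The block of `c 0` contains position `a`, so it can only be a node of `c' 0`. Applied both ways,
this equates the sizes of the first trees. -/
theorem numLeaves_zero_le {n : ℕ} {k k' : ℕ} {c : Fin (k + 1) → DecompTree}
    {c' : Fin (k' + 1) → DecompTree} (hc : ∀ i, (c i).Branching) (hc' : ∀ i, (c' i).Branching)
    {a : ℕ} (ha : a + ∑ i, (c i).numLeaves ≤ n) (ha' : a + ∑ i, (c' i).numLeaves ≤ n)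
    (h : forestBlocks n c a ⊆ forestBlocks n c' a) :
    (c 0).numLeaves ≤ (c' 0).numLeaves := by
  rw [Fin.sum_univ_succ] at ha ha'
  have hpos := (hc 0).numLeaves_pos
  have hpos' := (hc' 0).numLeaves_pos
  have h1 : block n a (c 0).numLeaves ∈ forestBlocks n c' a := h (by
    rw [forestBlocks_succ]
    exact Or.inl (self_mem_nodeBlocks n _ a))
  rw [forestBlocks_succ] at h1
  rcases h1 with h1 | h1
  · have := (mem_nodeBlocks (hc' 0) (by omega) h1).1
    rw [block_eq_seg, block_subset_iff (by omega) (by omega)] at this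
    omega
  · have := (mem_forestBlocks (fun i => hc' i.succ) (by omega) h1).1 ⟨a, by omega⟩
      ⟨le_rfl, by dsimp only; omega⟩
    dsimp only at this
    omega

/-- The first trees have equal size, and containment in that first block separates their nodes from
those of the tails; so the lists can be compared tree by tree. -/
theorem forest_eq {n : ℕ} {k k' : ℕ} {c : Fin k → DecompTree} {c' : Fin k' → DecompTree}
    (hc : ∀ i, (c i).Branching) (hc' : ∀ i, (c' i).Branching) {a : ℕ}
    (ha : a + ∑ i, (c i).numLeaves ≤ n)
    (hsum : ∑ i, (c i).numLeaves = ∑ i, (c' i).numLeaves)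
    (h : forestBlocks n c a = forestBlocks n c' a)
    (ih : ∀ i j, start c a i = start c' a j → (c i).numLeaves = (c' j).numLeaves →
      (c i).nodeBlocks n (start c a i) = (c' j).nodeBlocks n (start c' a j) → c i = c' j) :
    ∃ e : k = k', ∀ i, c i = c' (Fin.cast e i) := by
  induction k generalizing k' a with
  | zero =>
    cases k' with
    | zero => exact ⟨rfl, fun i => i.elim0⟩
    | succ k' =>
      have := (hc' 0).numLeaves_pos
      rw [Fin.sum_univ_zero, Fin.sum_univ_succ] at hsum
      omega
  | succ k ihk =>
    cases k' with
    | zero =>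
      have := (hc 0).numLeaves_pos
      rw [Fin.sum_univ_zero, Fin.sum_univ_succ] at hsum
      omega
    | succ k' =>
      have ha' : a + ∑ i, (c' i).numLeaves ≤ n := hsum ▸ ha
      have hnl := (numLeaves_zero_le hc hc' ha ha' h.subset).antisymm
        (numLeaves_zero_le hc' hc ha' ha h.superset)
      have h0 : c 0 = c' 0 := ih 0 0 (by rw [start_zero, start_zero]) hnl (by
        ext S
        rw [start_zero, start_zero, mem_nodeBlocks_zero_iff hc ha,
          mem_nodeBlocks_zero_iff hc' ha', h, hnl])
      rw [Fin.sum_univ_succ] at ha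
      rw [Fin.sum_univ_succ, Fin.sum_univ_succ] at hsum
      obtain ⟨e, he⟩ := ihk (k' := k') (c := fun i => c i.succ) (c' := fun i => c' i.succ)
        (fun i => hc i.succ) (fun i => hc' i.succ) (a := a + (c 0).numLeaves) (by omega) (by omega)
        (by
          ext S
          rw [← Fin.sum_univ_succ (fun i => (c i).numLeaves)] at ha
          rw [mem_forestBlocks_tail_iff hc ha, hnl, mem_forestBlocks_tail_iff hc' ha', h])
        (fun i j h1 h2 h3 => by
          refine ih i.succ j.succ ?_ h2 ?_
          · rw [start_succ, start_succ, h1, hnl]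
          · rw [start_succ, start_succ, h3, hnl])
      subst e
      refine ⟨rfl, fun i => ?_⟩
      induction i using Fin.cases with
      | zero => exact h0
      | succ i => exact he i

/-- Arity at least two is essential: an only child would have the same block as its parent. -/
theorem forestBlocks_eq {n : ℕ} {k : ℕ} {c : Fin k → DecompTree} (hk : 2 ≤ k)
    (hc : ∀ i, (c i).Branching) {a : ℕ} (ha : a + ∑ i, (c i).numLeaves ≤ n) (s : NodeSign) :
    forestBlocks n c a =
      (linear s k c).nodeBlocks n a \ {block n a (∑ i, (c i).numLeaves)} := by
  ext S
  simp only [nodeBlocks, Set.mem_sdiff, Set.mem_singleton_iff, Set.mem_union, numLeaves]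
  constructor
  · refine fun h => ⟨Or.inr h, ?_⟩
    rintro rfl
    obtain ⟨i, hi⟩ := Set.mem_iUnion.1 h
    have h1 := (mem_nodeBlocks (hc i) ((start_add_le_sum c a i).trans ha) hi).1
    have h2 := numLeaves_lt_sum hk (fun i => (hc i).numLeaves_pos) i
    rw [block_eq_seg, block_subset_iff (by omega) ha] at h1
    have h3 := le_start c a i
    omega
  · rintro ⟨h | h, h'⟩
    · exact absurd h h'
    · exact h

theorem SignCorrect.unique {n : ℕ} {σ : Equiv.Perm (Fin n)} {s s' : NodeSign} {k : ℕ}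
    {V : Fin k → Set (Fin n)} (hk : 2 ≤ k) (hV : ∀ i, (V i).Nonempty) (h : SignCorrect σ s V)
    (h' : SignCorrect σ s' V) : s = s' := by
  obtain ⟨p, hp⟩ := hV ⟨0, by omega⟩
  obtain ⟨q, hq⟩ := hV ⟨1, by omega⟩
  have hlt : (⟨0, by omega⟩ : Fin k) < ⟨1, by omega⟩ := Nat.one_pos
  cases s <;> cases s'
  · rfl
  · exact absurd (h _ _ hlt p hp q hq) (lt_asymm (h' _ _ hlt q hq p hp))
  · exact absurd (h' _ _ hlt p hp q hq) (lt_asymm (h _ _ hlt q hq p hp))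
  · rfl

theorem eq_of_nodeBlocks_eq {n : ℕ} {σ : Equiv.Perm (Fin n)} {T T' : DecompTree} {a : ℕ}
    (hT : T.Branching) (hT' : T'.Branching) (hlin : T.AllLinear) (hlin' : T'.AllLinear)
    (hL : T.LabelsCorrect σ a) (hL' : T'.LabelsCorrect σ a) (ha : a + T.numLeaves ≤ n)
    (hnl : T.numLeaves = T'.numLeaves) (h : T.nodeBlocks n a = T'.nodeBlocks n a) : T = T' := by
  induction T generalizing T' a with
  | leaf =>
    cases T' with
    | leaf => rfl
    | prime => exact hlin'.elim
    | linear s k c =>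
      have h1 := numLeaves_lt_sum hT'.1 (fun i => (hT'.2 i).numLeaves_pos)
        ⟨0, by have := hT'.1; omega⟩
      have h2 := (hT'.2 ⟨0, by have := hT'.1; omega⟩).numLeaves_pos
      rw [numLeaves, numLeaves] at hnl
      omega
  | prime => exact hlin.elim
  | linear s k c ih =>
    cases T' with
    | prime => exact hlin'.elim
    | leaf =>
      have h1 := numLeaves_lt_sum hT.1 (fun i => (hT.2 i).numLeaves_pos)
        ⟨0, by have := hT.1; omega⟩
      have h2 := (hT.2 ⟨0, by have := hT.1; omega⟩).numLeaves_pos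
      rw [numLeaves, numLeaves] at hnl
      omega
    | linear s' k' c' =>
      have hnl' : ∑ i, (c i).numLeaves = ∑ i, (c' i).numLeaves := hnl
      obtain ⟨e, he⟩ := forest_eq hT.2 hT'.2 ha hnl
        (by rw [forestBlocks_eq hT.1 hT.2 ha s, forestBlocks_eq hT'.1 hT'.2 (hnl' ▸ ha) s', h, hnl'])
        (fun i j h1 h2 h3 => by
          have := hL'.2.2 j
          rw [← h1] at this h3
          exact ih i (hT.2 i) (hT'.2 j) (hlin i) (hlin' j) (hL.2.2 i) this
            ((start_add_le_sum c a i).trans ha) h2 h3)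
      subst e
      obtain rfl : c = c' := funext he
      rw [SignCorrect.unique hT.1
        (fun i => (hT.2 i).block_nonempty ((start_add_le_sum c a i).trans ha)) hL.2.1 hL'.2.1]

theorem existsUnique_labeledDecompTree {n : ℕ} (hn : 0 < n) {σ : Equiv.Perm (Fin n)}
    (hσ : IsSeparablePerm σ) : ∃! T : DecompTree, T.IsLabeledDecompTreeOf σ := by
  have hu : block n 0 n = Set.univ := Set.eq_univ_of_forall fun p =>
    ⟨Nat.zero_le _, by have := p.isLt; omega⟩
  have hstrong : IsStrongInterval σ (block n 0 n) := by
    rw [hu]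
    refine ⟨isCommonInterval_univ hn σ, fun T _ h => ?_⟩
    obtain ⟨p, -, hp⟩ := h.2.1
    exact hp trivial
  obtain ⟨T, h1, h2, h3, h4⟩ := exists_tree hσ n 0 (by omega) hstrong
  have hT : T.IsLabeledDecompTreeOf σ :=
    ⟨h1, h2, fun S => by rw [h4, hu]; exact and_iff_left (Set.subset_univ _), h3⟩
  refine ⟨T, hT, fun T' hT' => ?_⟩
  obtain ⟨h1', h2', h4', h3'⟩ := hT'
  exact eq_of_nodeBlocks_eq h2' h2
    (allLinear_of_labelsCorrect hσ h2' (by omega) h3')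
    (allLinear_of_labelsCorrect hσ h2 (by omega) h3) h3' h3 (by omega) (by omega)
    (Set.ext fun S => (h4' S).trans (hT.2.2.1 S).symm)

/-! ## Expanding -/

/-! ### Counting signed nodes -/

/-- The number of internal linear nodes labeled `s`. -/
def numSigned (s : NodeSign) : DecompTree → ℕ
  | leaf => 0
  | linear t _ c => (if t = s then 1 else 0) + ∑ i, (c i).numSigned s
  | prime _ _ c => ∑ i, (c i).numSigned s

theorem numSigned_toDecompTree (s : NodeSign) (B : SignedBinTree) :
    B.toDecompTree.numSigned s = B.numSigned s := by
  induction B with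
  | leaf => rfl
  | node t l r ihl ihr =>
    simp [SignedBinTree.toDecompTree, numSigned, SignedBinTree.numSigned, ihl, ihr, Fin.sum_univ_two,
      add_assoc]

theorem numSigned_leftComb (s t : NodeSign) (k : ℕ) (c : Fin (k + 1) → DecompTree) :
    (leftComb t (k + 1) c).numSigned s =
      (if t = s then k else 0) + ∑ i, (c i).numSigned s := by
  induction k with
  | zero => simp [leftComb]
  | succ k ih =>
    rw [Fin.sum_univ_castSucc, leftComb, numSigned, Fin.sum_univ_two]
    simp only [Matrix.cons_val_zero, Matrix.cons_val_one, ih]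
    split_ifs <;> omega

theorem numSigned_expand (s : NodeSign) {T : DecompTree} (hT : T.Branching) :
    T.expand.numSigned s = T.linearExcess s := by
  induction T with
  | leaf => rfl
  | linear t k c ih =>
    obtain ⟨k, rfl⟩ : ∃ j, k = j + 1 := ⟨k - 1, by have := hT.1; omega⟩
    rw [expand, numSigned_leftComb, linearExcess, Nat.add_sub_cancel]
    simp only [fun i => ih i (hT.2 i)]
  | prime k π c ih =>
    rw [expand, numSigned, linearExcess]
    simp only [fun i => ih i (hT.2 i)]

/-! ### From combs to separating trees -/

theorem _root_.IsCommonInterval.exists_valueSet_eq {n : ℕ} {σ : Equiv.Perm (Fin n)}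
    {S : Set (Fin n)} (h : IsCommonInterval σ S) : ∃ i j, i < j ∧ valueSet σ S = Set.Ico i j := by
  -- The value set is itself a common interval of the identity, so `exists_seg` applies to it.
  have h' : IsCommonInterval (Equiv.refl (Fin n)) (σ '' S) := by
    refine ⟨h.1.image σ, h.2.2, ?_⟩
    simpa using h.2.2
  obtain ⟨i, j, hij, hj, he⟩ := h'.exists_seg
  refine ⟨i, j, hij, ?_⟩
  rw [valueSet, ← Set.image_image Fin.val, he]
  ext v
  constructor
  · rintro ⟨p, hp, rfl⟩
    exact hp
  · intro hv
    exact ⟨⟨v, lt_of_lt_of_le hv.2 hj⟩, hv, rfl⟩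

theorem exists_valueSet_eq_of_valuesBelow {n : ℕ} {σ : Equiv.Perm (Fin n)} {A B : Set (Fin n)}
    (hA : IsCommonInterval σ A) (hB : IsCommonInterval σ B) (hAB : IsCommonInterval σ (A ∪ B))
    (h : ValuesBelow σ A B) : ∃ i h j : ℕ, i < h ∧ h < j ∧ valueSet σ (A ∪ B) = Set.Ico i j ∧
      valueSet σ A = Set.Ico i h ∧ valueSet σ B = Set.Ico h j := by
  obtain ⟨i, u, hiu, hA'⟩ := hA.exists_valueSet_eq
  obtain ⟨v, j, hvj, hB'⟩ := hB.exists_valueSet_eq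
  obtain ⟨x, y, hxy, hAB'⟩ := hAB.exists_valueSet_eq
  have hun : valueSet σ (A ∪ B) = valueSet σ A ∪ valueSet σ B := Set.image_union _ _ _
  have hlt : ∀ p ∈ valueSet σ A, ∀ q ∈ valueSet σ B, p < q := by
    rintro _ ⟨p, hp, rfl⟩ _ ⟨q, hq, rfl⟩
    exact h p hp q hq
  rw [hA', hB'] at hlt
  have huv : u ≤ v := by
    have := hlt (u - 1) ⟨by omega, by omega⟩ v ⟨le_rfl, hvj⟩
    omega
  have hmem : ∀ w, (x ≤ w ∧ w < y) ↔ (i ≤ w ∧ w < u) ∨ (v ≤ w ∧ w < j) := fun w => by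
    have : w ∈ valueSet σ (A ∪ B) ↔ w ∈ valueSet σ A ∪ valueSet σ B := by rw [hun]
    rwa [hA', hB', hAB'] at this
  -- No gap: `u` lies between the members `i` and `j - 1` of the union, so it belongs to it, but not
  -- to `[i, u)`.
  have hvu : v = u := by
    have h1 := hmem i
    have h2 := hmem (j - 1)
    have h3 := hmem u
    omega
  subst hvu
  refine ⟨i, v, j, hiu, hvj, ?_, hA', hB'⟩
  rw [hun, hA', hB', Set.Ico_union_Ico_eq_Ico hiu.le hvj.le]

theorem separates_node {n : ℕ} {σ : Equiv.Perm (Fin n)} {s : NodeSign} {l r : SignedBinTree}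
    {a : ℕ} (hl : l.Separates σ a) (hr : r.Separates σ (a + l.numLeaves))
    (hA : IsCommonInterval σ (block n a l.numLeaves))
    (hB : IsCommonInterval σ (block n (a + l.numLeaves) r.numLeaves))
    (hAB : IsCommonInterval σ (block n a (l.numLeaves + r.numLeaves)))
    (h : match s with
      | .plus => ValuesBelow σ (block n a l.numLeaves) (block n (a + l.numLeaves) r.numLeaves)
      | .minus => ValuesBelow σ (block n (a + l.numLeaves) r.numLeaves) (block n a l.numLeaves)) :
    (SignedBinTree.node s l r).Separates σ a := by
  have hun : block n a (l.numLeaves + r.numLeaves) =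
      block n a l.numLeaves ∪ block n (a + l.numLeaves) r.numLeaves := by
    ext p
    simp only [Set.mem_union, mem_block]
    omega
  refine ⟨?_, hl, hr⟩
  rw [SignedBinTree.numLeaves, hun]
  rw [hun] at hAB
  cases s with
  | plus => exact exists_valueSet_eq_of_valuesBelow hA hB hAB h
  | minus =>
    rw [Set.union_comm] at hAB ⊢
    obtain ⟨i, m, j, h1, h2, h3, h4, h5⟩ := exists_valueSet_eq_of_valuesBelow hB hA hAB h
    exact ⟨i, m, j, h1, h2, h3, h5, h4⟩

/-- Two families are needed: `c` carries the original children, which fix the positions, and `d`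
their expansions, from which the comb is built. Induction removes the last child, the right child of
the comb's root. -/
theorem exists_separates_leftComb {n : ℕ} {σ : Equiv.Perm (Fin n)} {s : NodeSign} {k : ℕ}
    {c d : Fin (k + 1) → DecompTree} {a : ℕ}
    (hI : ∀ i j, i ≤ j → IsCommonInterval σ (childUnion n c a i j))
    (hs : SignCorrect σ s (childBlock n c a))
    (hB : ∀ i, ∃ B : SignedBinTree, B.toDecompTree = d i ∧ B.numLeaves = (c i).numLeaves ∧
      B.Separates σ (start c a i)) :
    ∃ B : SignedBinTree, B.toDecompTree = leftComb s (k + 1) d ∧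
      B.numLeaves = ∑ i, (c i).numLeaves ∧ B.Separates σ a := by
  induction k with
  | zero =>
    obtain ⟨B, h1, h2, h3⟩ := hB 0
    rw [start_zero] at h3
    exact ⟨B, h1, by simpa using h2, h3⟩
  | succ k ih =>
    have hblock : ∀ i : Fin (k + 1),
        childBlock n (fun j => c j.castSucc) a i = childBlock n c a i.castSucc := fun i => by
      rw [childBlock, childBlock, start_castSucc]
    obtain ⟨l, hl1, hl2, hl3⟩ := ih (c := fun i => c i.castSucc) (d := fun i => d i.castSucc)
      (fun i j hij => by
        have := hI i.castSucc j.castSucc hij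
        rw [childUnion_eq_seg _ _ _ (by exact hij), start_castSucc, start_castSucc] at this
        rwa [childUnion_eq_seg _ _ _ hij])
      (by
        rw [signCorrect_iff_orient] at hs ⊢
        intro i j hij
        rw [hblock, hblock]
        exact hs _ _ hij)
      (fun i => by
        obtain ⟨B, h1, h2, h3⟩ := hB i.castSucc
        exact ⟨B, h1, h2, by rwa [start_castSucc] at h3⟩)
    obtain ⟨r, hr1, hr2, hr3⟩ := hB (Fin.last (k + 1))
    have hstart : start c a (Fin.last (k + 1)) = a + l.numLeaves := by rw [start_last, hl2]
    have hlast : childBlock n c a (Fin.last (k + 1)) = block n (a + l.numLeaves) r.numLeaves := by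
      rw [childBlock, hstart, hr2]
    have hinit : childUnion n c a 0 (Fin.last k).castSucc = block n a l.numLeaves := by
      rw [childUnion_eq_seg _ _ _ (Fin.zero_le _), start_zero, start_castSucc, start_last,
        block_eq_seg, hl2, Fin.sum_univ_castSucc, add_assoc]
    refine ⟨.node s l r, ?_, ?_, separates_node hl3 (hstart ▸ hr3) ?_ ?_ ?_ ?_⟩
    · rw [SignedBinTree.toDecompTree, hl1, hr1, leftComb]
    · rw [SignedBinTree.numLeaves, hl2, hr2, ← Fin.sum_univ_castSucc (fun i => (c i).numLeaves)]
    · rw [← hinit]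
      exact hI _ _ (Fin.zero_le _)
    · have := hI (Fin.last (k + 1)) (Fin.last (k + 1)) le_rfl
      rwa [childUnion_eq_seg _ _ _ le_rfl, hstart, ← hr2] at this
    · have := hI 0 (Fin.last (k + 1)) (Fin.zero_le _)
      rwa [childUnion_eq_seg _ _ _ (Fin.zero_le _), hstart, ← hr2, start_zero, add_assoc] at this
    · have hex : ∀ p ∈ block n a l.numLeaves, ∃ i : Fin (k + 1),
          p ∈ childBlock n c a i.castSucc := fun p hp => by
        rw [mem_block, hl2] at hp
        obtain ⟨i, hi⟩ := exists_start_le_lt _ a hp.1 hp.2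
        exact ⟨i, by rw [← hblock]; exact hi⟩
      rw [← hlast]
      cases s with
      | plus =>
        intro p hp q hq
        obtain ⟨i, hi⟩ := hex p hp
        exact hs _ _ (Fin.castSucc_lt_last i) p hi q hq
      | minus =>
        intro q hq p hp
        obtain ⟨i, hi⟩ := hex p hp
        exact hs _ _ (Fin.castSucc_lt_last i) q hq p hi

theorem exists_separates_expand {n : ℕ} {σ : Equiv.Perm (Fin n)} {T : DecompTree}
    (hT : T.Branching) (hlin : T.AllLinear) {a : ℕ} (ha : a + T.numLeaves ≤ n)
    (hL : T.LabelsCorrect σ a) : ∃ B : SignedBinTree, B.toDecompTree = T.expand ∧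
      B.numLeaves = T.numLeaves ∧ B.Separates σ a := by
  induction T generalizing a with
  | leaf =>
    rw [numLeaves] at ha
    refine ⟨.leaf, rfl, rfl, (σ ⟨a, by omega⟩).val, ?_⟩
    have : block n a 1 = {⟨a, by omega⟩} := by
      ext p
      rw [mem_block, Set.mem_singleton_iff, Fin.ext_iff]
      dsimp only
      omega
    rw [valueSet, this, Set.image_singleton]
    ext v
    rw [Set.mem_singleton_iff, Set.mem_Ico]
    omega
  | prime => exact hlin.elim
  | linear s k c ih =>
    obtain ⟨k, rfl⟩ : ∃ j, k = j + 1 := ⟨k - 1, by have := hT.1; omega⟩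
    exact exists_separates_leftComb hL.1 hL.2.1 fun i =>
      ih i (hT.2 i) (hlin i) ((start_add_le_sum c a i).trans ha) (hL.2.2 i)

end DecompTree

theorem mainTheorem7 (n : ℕ) (hn : 0 < n) (σ : Equiv.Perm (Fin n)) (hσ : IsSeparablePerm σ) :
    (∃! T : DecompTree, T.IsLabeledDecompTreeOf σ) ∧
    (∃! E : DecompTree, E.IsExpandedDecompTreeOf σ) ∧
    (∀ E : DecompTree, E.IsExpandedDecompTreeOf σ →
      ∃ B : SignedBinTree, B.toDecompTree = E ∧ B.IsSeparatingTreeOf σ) ∧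
    (∀ T : DecompTree, T.IsLabeledDecompTreeOf σ →
      ∀ B : SignedBinTree, B.toDecompTree = T.expand →
        ∀ s : NodeSign, B.numSigned s = T.linearExcess s) := by
  have hex := DecompTree.existsUnique_labeledDecompTree hn hσ
  refine ⟨hex, ?_, ?_, ?_⟩
  · obtain ⟨T, hT, huniq⟩ := hex
    refine ⟨T.expand, ⟨T, hT, rfl⟩, ?_⟩
    rintro _ ⟨T', hT', rfl⟩
    rw [huniq T' hT']
  · rintro _ ⟨T, ⟨h1, h2, -, h3⟩, rfl⟩
    obtain ⟨B, h4, h5, h6⟩ := DecompTree.exists_separates_expand h2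
      (DecompTree.allLinear_of_labelsCorrect hσ h2 (by omega) h3) (by omega) h3
    exact ⟨B, h4, h5.trans h1, h6⟩
  · intro T hT B hB s
    rw [← DecompTree.numSigned_toDecompTree, hB, DecompTree.numSigned_expand s hT.2.1]
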